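/- Let $\square=(0,1)^2\subset\mathbb R^2$ and let $G_0$ be a finite union of smooth domains with pairwise disjoint closures, $\overline{G_0}\subset\square$. Let $Y=\overline{\square}\setminus\overline{G_0}$, and assume that $Y$ is connected and symmetric with respect to both lines $\{\xi_1=\tfrac12\}$ and $\{\xi_2=\tfrac12\}$. Put $E=\bigcup_{k\in\mathbb Z^2}(Y+k)$, let $\nu=(\nu_1,\nu_2)$ be the unit normal to $\partial G_0$ exterior to $Y$, and $\langle N\rangle_Y=\frac1{|Y|}\int_Y N\,d\xi$. Let $H^1_{per}(Y)$ be the space of functions on $E$ that are $1$-periodic in $\xi_1$ and $\xi_2$ and have weak first derivatives on $E$, the functions and these derivatives being square integrable over $Y$. For words $\alpha=(\alpha_1,\dots,\alpha_k)$, $\alpha_i\in\{1,2\}$, $|\alpha|=k$, let $N_\alpha$ ($k\ge 0$) be functions and $h_\alpha$ ($k\ge 2$) real constants such that $N_\alpha\equiv 1$ for the empty word and, for $k\ge1$, $N_\alpha\in H^1_{per}(Y)$ is a weak solution of the following problem: for $k=1$, $$\Delta N_\alpha=0\ \text{ in } Y,\qquad \partial_\nu N_\alpha=-\nu_{\alpha_1}\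 \text{ on }\partial G_0,\qquad \langle N_\alpha\rangle_Y=0,$$ and for $k\ge 2$, $$\Delta N_\alpha=h_\alpha-\delta_{\alpha_1,\alpha_2}N_{\alpha_3\dots\alpha_k}-2\,\partial_{\xi_{\alpha_1}}N_{\alpha_2\dots\alpha_k}\ \text{ in }Y,\qquad \partial_\nu N_\alpha=-\nu_{\alpha_1}N_{\alpha_2\dots\alpha_k}\ \text{ on }\partial G_0,\qquad\langle N_\alpha\rangle_Y=0.$$ Here a weak solution $N\in H^1_{per}(Y)$ of $\Delta N=F_0+\sum_i\partial_{\xi_i}F_i$ in $Y$, $\partial_\nu N=\sum_iF_i\nu_i$ on $\partial G_0$, is one with $-\int_Y\nabla N\cdot\nabla\varphi\,d\xi=\int_Y F_0\varphi\,d\xi-\int_Y\sum_iF_i\,\partial_{\xi_i}\varphi\,d\xi$ for all $\varphi\in H^1_{per}(Y)$; for $k\ge 1$ one takes $F_i=-\delta_{i,\alpha_1}N_{\alpha_2\dots\alpha_k}$, with $F_0=0$ if $k=1$ and $F_0=h_\alpha-\delta_{\alpha_1,\alpha_2}N_{\alpha_3\dots\alpha_k}-\partial_{\xi_{\alpha_1}}N_{\alpha_2\dots\alpha_k}$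 if $k\ge 2$. Let $S_l$ ($l=1,2$) be the reflection that changes the sign of the coordinate $\xi_l$. Then for every $\alpha$ with $|\alpha|\ge1$ and every $l\in\{1,2\}$ $$N_\alpha(S_l\xi)=(-1)^{\delta_{\alpha_1,l}+\dots+\delta_{\alpha_k,l}}N_\alpha(\xi)$$ for almost every $\xi\in E$, and for every $\xi\in\overline E$ if $N_\alpha$ is continuous on $\overline E$. Moreover, for $|\alpha|\ge2$, $h_\alpha=0$ if $|\alpha|$ is odd, and $h_\alpha=0$ if $(-1)^{\delta_{\alpha_1,l}+\dots+\delta_{\alpha_k,l}}=-1$ for at least one $l\in\{1,2\}$. -/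

import Mathlib

open MeasureTheory Topology
open scoped ContDiff

noncomputable section

namespace CellProblem

/-- The Euclidean plane `ℝ²`. The coordinate indices `1, 2` are `0, 1 : Fin 2`. -/
abbrev Plane : Type := EuclideanSpace ℝ (Fin 2)

/-- The open unit square. -/
def openSquare : Set Plane := {ξ | ∀ i, 0 < ξ i ∧ ξ i < 1}

/-- The closed unit square. -/
def closedSquare : Set Plane := {ξ | ∀ i, 0 ≤ ξ i ∧ ξ i ≤ 1}

/-- A smooth domain: a nonempty connected open set which near each of its boundary points is the
sublevel set `{ρ < 0}` of a `C^∞` function `ρ` whose differential does not vanish there. -/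
def IsSmoothDomain (U : Set Plane) : Prop :=
  IsOpen U ∧ IsConnected U ∧
    ∀ x ∈ frontier U, ∃ V ∈ 𝓝 x, ∃ ρ : Plane → ℝ,
      ContDiff ℝ ∞ ρ ∧ fderiv ℝ ρ x ≠ 0 ∧ U ∩ V = {y | ρ y < 0} ∩ V

/-- The periodicity cell `Y`: the closed unit square without the closed holes. -/
def cell (G : Set Plane) : Set Plane := closedSquare \ closure G

/-- The point of the integer lattice with coordinates `k`. -/
def lattice (k : Fin 2 → ℤ) : Plane := WithLp.toLp 2 fun i => (k i : ℝ)

/-- The perforated plane, the union of all translates of the cell by integer vectors. -/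
def perforatedPlane (G : Set Plane) : Set Plane := {ξ | ∃ k : Fin 2 → ℤ, ξ - lattice k ∈ cell G}

/-- The reflection `S_l`, which changes the sign of the coordinate `ξ_l`. -/
def reflect (l : Fin 2) (ξ : Plane) : Plane := WithLp.toLp 2 fun i => if i = l then -ξ i else ξ i

/-- The reflection in the line `ξ_l = 1/2`. -/
def mirror (l : Fin 2) (ξ : Plane) : Plane := WithLp.toLp 2 fun i => if i = l then 1 - ξ i else ξ i

/-- `G` is the set of holes of a symmetric perforated cell: a finite union of smooth domains with
pairwise disjoint closures (disjoint and not touching each other), whose closure lies in the open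
unit square, such that the cell is connected and symmetric in both lines `ξ_l = 1/2`. -/
structure IsSymmetricPerforation (G : Set Plane) : Prop where
  holes : ∃ (n : ℕ) (D : Fin n → Set Plane), (∀ i, IsSmoothDomain (D i)) ∧
    (∀ i j, i ≠ j → Disjoint (closure (D i)) (closure (D j))) ∧ G = ⋃ i, D i
  strictly_inside : closure G ⊆ openSquare
  connected : IsConnected (cell G)
  symmetric : ∀ l, mirror l ⁻¹' cell G = cell G

/-- `g` is the weak partial derivative of `f` with respect to the `i`-th coordinate on `U`. -/
def HasWeakPartial (U : Set Plane) (f g : Plane → ℝ) (i : Fin 2) : Prop :=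
  LocallyIntegrableOn f U ∧ LocallyIntegrableOn g U ∧
    ∀ ψ : Plane → ℝ, ContDiff ℝ ∞ ψ → HasCompactSupport ψ → tsupport ψ ⊆ U →
      ∫ ξ in U, f ξ * fderiv ℝ ψ ξ (EuclideanSpace.single i 1) = -∫ ξ in U, g ξ * ψ ξ

/-- `u` (a representative of) an element of `H¹_per(Y)` with weak gradient `du`: a function on the
perforated plane, `1`-periodic in both variables, with weak partial derivatives `du 0`, `du 1`,
all of them square integrable over the cell. Equalities of values are meant almost everywhere. -/
structure MemH1per (G : Set Plane) (u : Plane → ℝ) (du : Fin 2 → Plane → ℝ) : Prop where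
  periodic : ∀ k : Fin 2 → ℤ,
    ∀ᵐ ξ ∂(volume.restrict (perforatedPlane G)), u (ξ + lattice k) = u ξ
  memLp : MemLp u 2 (volume.restrict (cell G))
  memLp_grad : ∀ i, MemLp (du i) 2 (volume.restrict (cell G))
  weak_grad : ∀ i, HasWeakPartial (perforatedPlane G) u (du i) i

/-- `u ∈ H¹_per(Y)`, with weak gradient `du`, is a weak solution of the periodic Neumann problem
`Δu = F₀ + ∂₁F₁ + ∂₂F₂` in `Y`, `∂_ν u = F₁ν₁ + F₂ν₂` on the boundary of the holes, `⟨u⟩_Y = 0`: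
the equation is multiplied by a test function `φ ∈ H¹_per(Y)` and integrated by parts, where the
boundary integrals over the holes cancel by the Neumann condition and those over the sides of the
square cancel by periodicity. -/
structure IsWeakSolution (G : Set Plane) (F₀ : Plane → ℝ) (F : Fin 2 → Plane → ℝ)
    (u : Plane → ℝ) (du : Fin 2 → Plane → ℝ) : Prop where
  mem : MemH1per G u du
  equation : ∀ (φ : Plane → ℝ) (dφ : Fin 2 → Plane → ℝ), MemH1per G φ dφ →
    -∫ ξ in cell G, ∑ i, du i ξ * dφ i ξ =
      (∫ ξ in cell G, F₀ ξ * φ ξ) - ∫ ξ in cell G, ∑ i, F i ξ * dφ i ξ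
  mean_zero : ⨍ ξ in cell G, u ξ = 0

/-- The term `F₀` of the problem for the corrector `N_α`: it is `0` if `|α| = 1`, and
`h_α - δ_{α₁α₂} N_{α₃…α_k} - ∂_{α₁} N_{α₂…α_k}` if `|α| ≥ 2`. -/
def source (N : List (Fin 2) → Plane → ℝ) (DN : List (Fin 2) → Fin 2 → Plane → ℝ)
    (h : List (Fin 2) → ℝ) : List (Fin 2) → Plane → ℝ
  | [] => fun _ => 0
  | [_] => fun _ => 0
  | a :: b :: γ => fun ξ => h (a :: b :: γ) - (if a = b then N γ ξ else 0) - DN (b :: γ) a ξ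

/-- The term `(F₁, F₂)` of the problem for the corrector `N_α`, namely
`F_i = -δ_{i α₁} N_{α₂…α_k}`. -/
def flux (N : List (Fin 2) → Plane → ℝ) : List (Fin 2) → Fin 2 → Plane → ℝ
  | [] => fun _ _ => 0
  | a :: β => fun i ξ => if i = a then -N β ξ else 0

/-- `N` is a family of cell correctors, indexed by the words `α` in the two letters, with weak
gradients `DN`, and `h` is the corresponding family of constants: `N_∅ = 1`, and `N_α` solves
* for `α = (a)`: `ΔN_α = 0` in `Y`, `∂_ν N_α = -ν_a` on the holes, `⟨N_α⟩_Y = 0`;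
* for `|α| ≥ 2`: `ΔN_α = h_α - δ_{α₁α₂} N_{α₃…α_k} - 2 ∂_{α₁} N_{α₂…α_k}` in `Y`,
  `∂_ν N_α = -ν_{α₁} N_{α₂…α_k}` on the holes, `⟨N_α⟩_Y = 0`.
One of the two copies of `-∂_{α₁} N_{α₂…α_k}` is in `source`, the other is the divergence of
`flux`. The values of `h` at words of length less than two do not matter. -/
structure IsCellCorrectors (G : Set Plane) (N : List (Fin 2) → Plane → ℝ)
    (DN : List (Fin 2) → Fin 2 → Plane → ℝ) (h : List (Fin 2) → ℝ) : Prop where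
  empty : ∀ ξ, N [] ξ = 1
  solves : ∀ α : List (Fin 2), 1 ≤ α.length →
    IsWeakSolution G (source N DN h α) (flux N α) (N α) (DN α)

end CellProblem

end

noncomputable section

namespace CellProblem

/-! ### The perforated plane -/

/-! On periodic functions `S_l` acts like the mirror `ξ_l ↦ 1 - ξ_l`, from which it differs by a
lattice vector. The mirror maps `Y` onto itself, so the symmetry can be read off from the weak
formulation on the cell.

The core is `IsWeakSolution.parity`. If the data have parity `s = ±1` under the mirror (with the
extra vector sign on the flux), let `w` be `s` times the mirrored solution minus the solution `u`.
Then `w` is an admissible test function of parity `-s`. Its pairings with the data are integrals of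
odd functions, so `∫ ∇u · ∇w = 0`. Adding the mirrored copy of this integral gives `-∫ |∇w|² = 0`.
Since `Y` is connected, `w` is constant there, and zero mean makes it vanish.

Induction on the word supplies the parity of the data: each letter `l` contributes one sign, whether
through a derivative or through a component of the flux. Testing with `φ = 1` shows that the source
has zero mean. When the word is odd in `l`, the non-constant part of the source already integrates
to zero, so `h_α = 0`; this has to be known before the parity of `N_α` itself. A word of odd length
is odd in one of its two letters. -/

lemma lattice_apply (k : Fin 2 → ℤ) (i : Fin 2) : lattice k i = k i := rfl

lemma lattice_add (k m : Fin 2 → ℤ) : lattice (k + m) = lattice k + lattice m := by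
  ext i; simp [lattice]

lemma lattice_neg (k : Fin 2 → ℤ) : lattice (-k) = -lattice k := by
  ext i; simp [lattice]

lemma lattice_zero : lattice 0 = 0 := by
  ext i; simp [lattice]

lemma mirror_apply (l : Fin 2) (ξ : Plane) (i : Fin 2) :
    mirror l ξ i = if i = l then 1 - ξ i else ξ i := rfl

lemma reflect_apply (l : Fin 2) (ξ : Plane) (i : Fin 2) :
    reflect l ξ i = if i = l then -ξ i else ξ i := rfl

lemma mirror_mirror (l : Fin 2) (ξ : Plane) : mirror l (mirror l ξ) = ξ := by
  ext i; by_cases h : i = l <;> simp [mirror_apply, h]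

lemma mirror_eq_reflect_add (l : Fin 2) (ξ : Plane) :
    mirror l ξ = reflect l ξ + lattice (Pi.single l 1) := by
  ext i; by_cases h : i = l
  · subst h; simp [mirror_apply, reflect_apply, lattice_apply]; ring
  · simp [mirror_apply, reflect_apply, lattice_apply, h]

lemma mirror_add_lattice (l : Fin 2) (ξ : Plane) (k : Fin 2 → ℤ) :
    mirror l (ξ + lattice k) = mirror l ξ + lattice (fun i => if i = l then -k i else k i) := by
  ext i; by_cases h : i = l <;> simp [mirror_apply, lattice_apply, h]; ring

lemma eq_of_openSquare_of_closedSquare {ξ : Plane} {k m : Fin 2 → ℤ}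
    (hk : ξ - lattice k ∈ openSquare) (hm : ξ - lattice m ∈ closedSquare) : k = m := by
  funext i
  have h1 := hk i
  have h2 := hm i
  simp only [PiLp.sub_apply, lattice_apply] at h1 h2
  have a : k i < m i + 1 := by exact_mod_cast (by linarith : (k i : ℝ) < m i + 1)
  have b : m i < k i + 1 := by exact_mod_cast (by linarith : (m i : ℝ) < k i + 1)
  omega

lemma exists_sub_lattice_mem_closedSquare (ξ : Plane) :
    ∃ k : Fin 2 → ℤ, ξ - lattice k ∈ closedSquare := by
  refine ⟨fun i => ⌊ξ i⌋, fun i => ?_⟩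
  simp only [PiLp.sub_apply, lattice_apply]
  constructor <;> linarith [Int.floor_le (ξ i), Int.lt_floor_add_one (ξ i)]

lemma cell_subset_perforatedPlane (G : Set Plane) : cell G ⊆ perforatedPlane G :=
  fun ξ hξ => ⟨0, by simpa [lattice_zero] using hξ⟩

/-- Adjacent closed squares share sides, but the holes stay off them, so a translated hole meets
only its own cell. Thus the union of cells is the complement of the periodic array of closed holes.
-/
lemma mem_perforatedPlane_iff {G : Set Plane} (hG : closure G ⊆ openSquare) {ξ : Plane} :
    ξ ∈ perforatedPlane G ↔ ∀ k, ξ - lattice k ∉ closure G := by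
  constructor
  · rintro ⟨m, hm⟩ k hk
    obtain rfl := eq_of_openSquare_of_closedSquare (hG hk) hm.1
    exact hm.2 hk
  · intro h
    obtain ⟨k, hk⟩ := exists_sub_lattice_mem_closedSquare ξ
    exact ⟨k, hk, h k⟩

lemma isClosed_closedSquare : IsClosed closedSquare := by
  simp only [closedSquare, Set.ofPred_forall]
  refine isClosed_iInter fun i => ?_
  have : Continuous fun ξ : Plane => ξ i := by fun_prop
  exact (isClosed_le continuous_const this).inter (isClosed_le this continuous_const)

lemma isBounded_closedSquare : Bornology.IsBounded closedSquare := by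
  refine (Metric.isBounded_iff_subset_closedBall 0).2 ⟨2, fun ξ hξ => ?_⟩
  rw [mem_closedBall_zero_iff, EuclideanSpace.norm_eq]
  refine Real.sqrt_le_iff.2 ⟨by norm_num, ?_⟩
  have h0 := hξ 0
  have h1 := hξ 1
  simp only [Fin.sum_univ_two, Real.norm_eq_abs, sq_abs]
  nlinarith

lemma openSquare_subset_closedSquare : openSquare ⊆ closedSquare :=
  fun _ h i => ⟨(h i).1.le, (h i).2.le⟩

lemma isClosed_range_lattice : IsClosed (Set.range lattice) := by
  have : Set.range lattice = ⋂ i : Fin 2, (fun ξ : Plane => ξ i) ⁻¹' Set.range ((↑) : ℤ → ℝ) := by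
    ext ξ
    simp only [Set.mem_range, Set.mem_iInter, Set.mem_preimage]
    constructor
    · rintro ⟨k, rfl⟩ i
      exact ⟨k i, rfl⟩
    · intro h
      choose k hk using h
      exact ⟨k, by ext i; exact hk i⟩
  rw [this]
  exact isClosed_iInter fun i => Int.isClosedEmbedding_coe_real.isClosed_range.preimage
    (by fun_prop)

-- The complement is the sum of a compact set and the closed lattice, hence closed. Openness lets
-- weak derivatives on the perforated plane be tested around every point of `Y`, including the sides
-- of the square.
open scoped Pointwise in
lemma isOpen_perforatedPlane {G : Set Plane} (hG : closure G ⊆ openSquare) :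
    IsOpen (perforatedPlane G) := by
  have hc : IsCompact (closure G) := Metric.isCompact_of_isClosed_isBounded isClosed_closure
    (isBounded_closedSquare.subset (hG.trans openSquare_subset_closedSquare))
  have : (perforatedPlane G)ᶜ = closure G + Set.range lattice := by
    ext ξ
    rw [Set.mem_compl_iff, mem_perforatedPlane_iff hG, Set.mem_add]
    push Not
    constructor
    · rintro ⟨k, hk⟩
      exact ⟨_, hk, _, ⟨k, rfl⟩, by simp⟩
    · rintro ⟨x, hx, _, ⟨k, rfl⟩, rfl⟩
      exact ⟨k, by simpa using hx⟩
  rw [← isClosed_compl_iff, this]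
  exact isClosed_range_lattice.add_left_of_isCompact hc

lemma measurableSet_cell (G : Set Plane) : MeasurableSet (cell G) :=
  isClosed_closedSquare.measurableSet.diff isClosed_closure.measurableSet

lemma volume_cell_lt_top (G : Set Plane) : volume (cell G) < ⊤ :=
  (measure_mono Set.sdiff_subset).trans_lt isBounded_closedSquare.measure_lt_top

lemma add_lattice_mem_perforatedPlane_iff {G : Set Plane} (k : Fin 2 → ℤ) (ξ : Plane) :
    ξ + lattice k ∈ perforatedPlane G ↔ ξ ∈ perforatedPlane G := by
  constructor
  · rintro ⟨m, hm⟩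
    exact ⟨m - k, by rw [sub_eq_add_neg m, lattice_add, lattice_neg]; convert hm using 1; abel⟩
  · rintro ⟨m, hm⟩
    exact ⟨m + k, by rw [lattice_add]; convert hm using 1; abel⟩

lemma IsSymmetricPerforation.isOpen {G : Set Plane} (hG : IsSymmetricPerforation G) :
    IsOpen (perforatedPlane G) :=
  isOpen_perforatedPlane hG.strictly_inside

lemma IsSymmetricPerforation.mirror_mem {G : Set Plane} (hG : IsSymmetricPerforation G)
    (l : Fin 2) {ξ : Plane} (hξ : ξ ∈ perforatedPlane G) : mirror l ξ ∈ perforatedPlane G := by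
  obtain ⟨k, hk⟩ := hξ
  rw [← hG.symmetric l, Set.mem_preimage, sub_eq_add_neg, ← lattice_neg, mirror_add_lattice] at hk
  exact (add_lattice_mem_perforatedPlane_iff _ _).1 (cell_subset_perforatedPlane G hk)

lemma IsSymmetricPerforation.mirror_preimage {G : Set Plane} (hG : IsSymmetricPerforation G)
    (l : Fin 2) : mirror l ⁻¹' perforatedPlane G = perforatedPlane G := by
  ext ξ
  refine ⟨fun h => ?_, hG.mirror_mem l⟩
  simpa [mirror_mirror] using hG.mirror_mem l h

lemma IsSymmetricPerforation.reflect_preimage {G : Set Plane} (hG : IsSymmetricPerforation G)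
    (l : Fin 2) : reflect l ⁻¹' perforatedPlane G = perforatedPlane G := by
  conv_rhs => rw [← hG.mirror_preimage l]
  ext ξ
  rw [Set.mem_preimage, Set.mem_preimage, mirror_eq_reflect_add,
    add_lattice_mem_perforatedPlane_iff]

/-! ### Isometries of the plane -/

lemma measurePreserving_affineIsometryEquiv (T : Plane ≃ᵃⁱ[ℝ] Plane) :
    MeasurePreserving T volume volume := by
  have : (T : Plane → Plane) = (fun ξ => ξ + T 0) ∘ T.linearIsometryEquiv := by
    funext ξ
    simpa using T.map_vadd 0 ξ
  rw [this]
  exact (measurePreserving_add_right volume _).comp T.linearIsometryEquiv.measurePreserving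

/-- The reflection `S_l` as a linear isometry. -/
def reflectIso (l : Fin 2) : Plane ≃ₗᵢ[ℝ] Plane :=
  LinearIsometryEquiv.piLpCongrRight 2 fun i =>
    if i = l then LinearIsometryEquiv.neg ℝ else LinearIsometryEquiv.refl ℝ ℝ

lemma coe_reflectIso (l : Fin 2) : (reflectIso l : Plane → Plane) = reflect l := by
  funext ξ
  ext i
  by_cases h : i = l <;> simp [reflectIso, reflect_apply, h]

/-- The translation by a lattice vector. -/
def shiftIso (k : Fin 2 → ℤ) : Plane ≃ᵃⁱ[ℝ] Plane :=
  AffineIsometryEquiv.vaddConst ℝ (lattice k)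

lemma shiftIso_apply (k : Fin 2 → ℤ) (ξ : Plane) : shiftIso k ξ = ξ + lattice k := rfl

/-- The reflection in the line `ξ_l = 1/2` as an affine isometry. -/
def mirrorIso (l : Fin 2) : Plane ≃ᵃⁱ[ℝ] Plane :=
  (reflectIso l).toAffineIsometryEquiv.trans (shiftIso (Pi.single l 1))

lemma coe_mirrorIso (l : Fin 2) : (mirrorIso l : Plane → Plane) = mirror l := by
  funext ξ
  rw [mirror_eq_reflect_add, ← coe_reflectIso]
  rfl

/-- The sign by which the reflection `S_l` changes the `i`-th coordinate. -/
def reflSign (l i : Fin 2) : ℝ := if i = l then -1 else 1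

lemma reflSign_mul_self (l i : Fin 2) : reflSign l i * reflSign l i = 1 := by
  by_cases h : i = l <;> simp [reflSign, h]

lemma shiftIso_linear (k : Fin 2 → ℤ) (v : Plane) : (shiftIso k).linearIsometryEquiv v = v := rfl

lemma mirrorIso_linear (l i : Fin 2) :
    (mirrorIso l).linearIsometryEquiv (EuclideanSpace.single i 1) =
      reflSign l i • (EuclideanSpace.single i 1 : Plane) := by
  change reflectIso l _ = _
  rw [coe_reflectIso]
  ext j
  rcases eq_or_ne j i with rfl | h
  · by_cases h' : j = l <;> simp [reflect_apply, reflSign, h']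
  · simp [reflect_apply, h]

lemma IsSymmetricPerforation.measurePreserving_mirror_restrict {G : Set Plane}
    (hG : IsSymmetricPerforation G) (l : Fin 2) :
    MeasurePreserving (mirror l) (volume.restrict (perforatedPlane G))
      (volume.restrict (perforatedPlane G)) := by
  have h := (measurePreserving_affineIsometryEquiv (mirrorIso l)).restrict_preimage
    hG.isOpen.measurableSet
  rwa [coe_mirrorIso, hG.mirror_preimage] at h

lemma IsSymmetricPerforation.measurePreserving_reflect_restrict {G : Set Plane}
    (hG : IsSymmetricPerforation G) (l : Fin 2) :
    MeasurePreserving (reflect l) (volume.restrict (perforatedPlane G))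
      (volume.restrict (perforatedPlane G)) := by
  have h := ((reflectIso l).measurePreserving).restrict_preimage hG.isOpen.measurableSet
  rwa [coe_reflectIso, hG.reflect_preimage] at h

lemma IsSymmetricPerforation.measurePreserving_mirror_restrict_cell {G : Set Plane}
    (hG : IsSymmetricPerforation G) (l : Fin 2) :
    MeasurePreserving (mirror l) (volume.restrict (cell G)) (volume.restrict (cell G)) := by
  have h := (measurePreserving_affineIsometryEquiv (mirrorIso l)).restrict_preimage
    (measurableSet_cell G)
  rwa [coe_mirrorIso, hG.symmetric] at h

lemma IsSymmetricPerforation.integral_cell_comp_mirror {G : Set Plane}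
    (hG : IsSymmetricPerforation G) (l : Fin 2) (f : Plane → ℝ) :
    ∫ ξ in cell G, f (mirror l ξ) = ∫ ξ in cell G, f ξ := by
  refine (hG.measurePreserving_mirror_restrict_cell l).integral_comp ?_ f
  rw [← coe_mirrorIso]
  exact (mirrorIso l).toHomeomorph.measurableEmbedding

/-- A function that is odd under the reflection of the cell has integral zero over the cell. -/
lemma IsSymmetricPerforation.integral_cell_eq_zero_of_odd {G : Set Plane}
    (hG : IsSymmetricPerforation G) (l : Fin 2) {f : Plane → ℝ}
    (hf : ∀ᵐ ξ ∂(volume.restrict (cell G)), f (mirror l ξ) = -f ξ) :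
    ∫ ξ in cell G, f ξ = 0 := by
  have h := hG.integral_cell_comp_mirror l f
  rw [integral_congr_ae hf, integral_neg] at h
  linarith

/-! ### Passing from the cell to the perforated plane -/

/-- There are countably many lattice vectors, so the exceptional null sets of all translates can be
discarded together. -/
lemma ae_perforatedPlane_of_ae_cell {G : Set Plane} {p : Plane → ℝ}
    (hper : ∀ k : Fin 2 → ℤ,
      ∀ᵐ ξ ∂(volume.restrict (perforatedPlane G)), p (ξ + lattice k) = p ξ)
    (h : ∀ᵐ ξ ∂(volume.restrict (cell G)), p ξ = 0) (hG : closure G ⊆ openSquare) :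
    ∀ᵐ ξ ∂(volume.restrict (perforatedPlane G)), p ξ = 0 := by
  rw [ae_restrict_iff' (measurableSet_cell G)] at h
  have hk : ∀ k : Fin 2 → ℤ, ∀ᵐ ξ, ξ + lattice k ∈ cell G → p (ξ + lattice k) = 0 := fun k =>
    (measurePreserving_affineIsometryEquiv (shiftIso k)).quasiMeasurePreserving.ae h
  have hE := (isOpen_perforatedPlane hG).measurableSet
  have h1 := ae_all_iff.2 hper
  rw [ae_restrict_iff' hE] at h1 ⊢
  filter_upwards [h1, ae_all_iff.2 hk] with ξ a b hξ
  obtain ⟨k, hk⟩ := hξ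
  rw [← a ⟨k, hk⟩ (-k)]
  apply b
  rwa [lattice_neg, ← sub_eq_add_neg]

/-- If `Y` were null, its translates would make the nonempty open perforated plane null; this is the
previous transfer applied to the constant `1`. -/
lemma IsSymmetricPerforation.volume_cell_ne_zero {G : Set Plane}
    (hG : IsSymmetricPerforation G) : volume (cell G) ≠ 0 := by
  intro h0
  have h : ∀ᵐ ξ ∂(volume.restrict (perforatedPlane G)), (1 : ℝ) = 0 :=
    ae_perforatedPlane_of_ae_cell (p := fun _ => 1) (fun _ => by simp)
      (by rw [Measure.restrict_eq_zero.2 h0]; simp) hG.strictly_inside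
  simp only [one_ne_zero, Filter.eventually_false_iff_eq_bot, ae_eq_bot,
    Measure.restrict_eq_zero] at h
  rw [hG.isOpen.measure_eq_zero_iff volume] at h
  exact (hG.connected.nonempty.mono (cell_subset_perforatedPlane G)).ne_empty h

/-! ### Weak partial derivatives -/

section WeakPartial

variable {U : Set Plane} {f g f' g' : Plane → ℝ} {i : Fin 2}

lemma locallyIntegrableOn_comp_affineIsometryEquiv (T : Plane ≃ᵃⁱ[ℝ] Plane) (hU : IsOpen U)
    (hT : T ⁻¹' U = U) (hf : LocallyIntegrableOn f U) :
    LocallyIntegrableOn (fun ξ => f (T ξ)) U := by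
  rw [locallyIntegrableOn_iff hU.isLocallyClosed] at hf ⊢
  intro K hK hKc
  have hpre : T ⁻¹' (T '' K) = K := T.injective.preimage_image K
  have h := hf (T '' K) ?_ (hKc.image T.continuous)
  · rw [← (measurePreserving_affineIsometryEquiv T).integrableOn_comp_preimage
      T.toHomeomorph.measurableEmbedding, hpre] at h
    exact h
  · rintro _ ⟨ξ, hξ, rfl⟩
    have := hK hξ
    rwa [← hT] at this

lemma integrable_mul_of_tsupport_subset (hf : LocallyIntegrableOn f U)
    (hg : Continuous g) (hc : HasCompactSupport g) (hs : tsupport g ⊆ U) :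
    Integrable fun ξ => f ξ * g ξ := by
  have h : IntegrableOn (fun ξ => f ξ * g ξ) (tsupport g) :=
    (hf.integrableOn_compact_subset hs hc).mul_continuousOn hg.continuousOn hc
  refine (integrableOn_iff_integrable_of_support_subset ?_).1 h
  exact (Function.support_mul_subset_right _ _).trans (subset_tsupport g)

lemma setIntegral_mul_of_tsupport_subset (hs : tsupport g ⊆ U) :
    ∫ ξ in U, f ξ * g ξ = ∫ ξ, f ξ * g ξ :=
  setIntegral_eq_integral_of_forall_compl_eq_zero fun ξ hξ => by
    rw [image_eq_zero_of_notMem_tsupport fun h => hξ (hs h), mul_zero]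

lemma continuous_partial {ψ : Plane → ℝ} (hψ : ContDiff ℝ ∞ ψ) (v : Plane) :
    Continuous fun ξ => fderiv ℝ ψ ξ v :=
  (hψ.continuous_fderiv (by simp)).clm_apply continuous_const

lemma hasCompactSupport_partial {ψ : Plane → ℝ} (hψ : HasCompactSupport ψ) (v : Plane) :
    HasCompactSupport fun ξ => fderiv ℝ ψ ξ v :=
  hψ.fderiv_apply (𝕜 := ℝ) v

lemma tsupport_partial_subset {ψ : Plane → ℝ} (v : Plane) :
    tsupport (fun ξ => fderiv ℝ ψ ξ v) ⊆ tsupport ψ :=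
  tsupport_fderiv_apply_subset ℝ v

lemma HasWeakPartial.sub (h : HasWeakPartial U f g i) (h' : HasWeakPartial U f' g' i) :
    HasWeakPartial U (fun ξ => f ξ - f' ξ) (fun ξ => g ξ - g' ξ) i := by
  refine ⟨h.1.sub h'.1, h.2.1.sub h'.2.1, fun ψ hψ hc hs => ?_⟩
  have hs' := (tsupport_partial_subset (EuclideanSpace.single i 1)).trans hs
  simp only [sub_mul]
  rw [integral_sub, integral_sub, h.2.2 ψ hψ hc hs, h'.2.2 ψ hψ hc hs]
  · ring
  · exact (integrable_mul_of_tsupport_subset h.2.1 hψ.continuous hc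
      hs).integrableOn
  · exact (integrable_mul_of_tsupport_subset h'.2.1 hψ.continuous hc
      hs).integrableOn
  · exact (integrable_mul_of_tsupport_subset h.1
      (continuous_partial hψ _) (hasCompactSupport_partial hc _) hs').integrableOn
  · exact (integrable_mul_of_tsupport_subset h'.1
      (continuous_partial hψ _) (hasCompactSupport_partial hc _) hs').integrableOn

lemma HasWeakPartial.const_mul (h : HasWeakPartial U f g i) (c : ℝ) :
    HasWeakPartial U (fun ξ => c * f ξ) (fun ξ => c * g ξ) i := by
  refine ⟨h.1.smul c, h.2.1.smul c, fun ψ hψ hc hs => ?_⟩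
  simp only [mul_assoc]
  rw [integral_const_mul, integral_const_mul, h.2.2 ψ hψ hc hs, mul_neg]

/-- Change of variables, with `ψ ∘ T⁻¹` as the test function. The condition `hL` keeps the partial
derivatives from mixing; it covers lattice shifts (`σ = 1`) and mirrors (`σ = ±1`). -/
lemma HasWeakPartial.comp_affineIsometryEquiv (h : HasWeakPartial U f g i) (hU : IsOpen U)
    (T : Plane ≃ᵃⁱ[ℝ] Plane) (hT : T ⁻¹' U = U) {σ : ℝ}
    (hL : T.linearIsometryEquiv (EuclideanSpace.single i 1) =
      σ • (EuclideanSpace.single i 1 : Plane)) :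
    HasWeakPartial U (fun ξ => f (T ξ)) (fun ξ => σ * g (T ξ)) i := by
  refine ⟨locallyIntegrableOn_comp_affineIsometryEquiv T hU hT h.1,
    (locallyIntegrableOn_comp_affineIsometryEquiv T hU hT h.2.1).smul σ, fun ψ hψ hc hs => ?_⟩
  have key : ∀ p : Plane → ℝ, ∫ ξ in U, p (T ξ) = ∫ ξ in U, p ξ := fun p => by
    have := (measurePreserving_affineIsometryEquiv T).setIntegral_preimage_emb
      T.toHomeomorph.measurableEmbedding p U
    rwa [hT] at this
  have hTd : ∀ ξ, HasFDerivAt T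
      (T.linearIsometryEquiv.toContinuousLinearEquiv : Plane →L[ℝ] Plane) ξ := fun ξ => by
    have : (T : Plane → Plane) = fun ξ => T.linearIsometryEquiv ξ + T 0 := by
      funext ξ
      simpa using T.map_vadd 0 ξ
    rw [this]
    exact (T.linearIsometryEquiv.toContinuousLinearEquiv.hasFDerivAt).add_const _
  let ρ : Plane → ℝ := fun ξ => ψ (T.symm ξ)
  have hρ : ContDiff ℝ ∞ ρ := by
    have : (T.symm : Plane → Plane) = fun ξ => T.symm.linearIsometryEquiv ξ + T.symm 0 := by
      funext ξ
      simpa using T.symm.map_vadd 0 ξ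
    refine hψ.comp ?_
    rw [this]
    exact T.symm.linearIsometryEquiv.contDiff.add contDiff_const
  have hρc : HasCompactSupport ρ := hc.comp_homeomorph T.symm.toHomeomorph
  have hρs : tsupport ρ ⊆ U := by
    have h1 : tsupport ρ = T.symm ⁻¹' tsupport ψ :=
      tsupport_comp_eq_preimage ψ T.symm.toHomeomorph
    rw [h1]
    intro ξ hξ
    have := hs hξ
    rw [← hT] at this
    simpa using this
  have hψρ : ψ = ρ ∘ T := by
    funext ξ
    simp [ρ]
  have hd : ∀ ξ, fderiv ℝ ψ ξ (EuclideanSpace.single i 1) =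
      σ * fderiv ℝ ρ (T ξ) (EuclideanSpace.single i 1) := fun ξ => by
    have h1 := ((hρ.differentiable (by simp) (T ξ)).hasFDerivAt.comp ξ (hTd ξ)).fderiv
    rw [← hψρ] at h1
    rw [h1, ContinuousLinearMap.comp_apply]
    change fderiv ℝ ρ (T ξ) (T.linearIsometryEquiv _) = _
    rw [hL, map_smul, smul_eq_mul]
  calc ∫ ξ in U, f (T ξ) * fderiv ℝ ψ ξ (EuclideanSpace.single i 1)
      = ∫ ξ in U, f (T ξ) * (σ * fderiv ℝ ρ (T ξ) (EuclideanSpace.single i 1)) := by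
        simp only [hd]
    _ = ∫ ξ in U, f ξ * (σ * fderiv ℝ ρ ξ (EuclideanSpace.single i 1)) :=
        key fun ξ => f ξ * (σ * fderiv ℝ ρ ξ (EuclideanSpace.single i 1))
    _ = σ * ∫ ξ in U, f ξ * fderiv ℝ ρ ξ (EuclideanSpace.single i 1) := by
        rw [← integral_const_mul]
        simp only [mul_left_comm]
    _ = -∫ ξ in U, σ * g ξ * ρ ξ := by
        rw [h.2.2 ρ hρ hρc hρs, mul_neg, ← integral_const_mul]
        simp only [mul_assoc]
    _ = -∫ ξ in U, σ * g (T ξ) * ρ (T ξ) := by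
        rw [key fun ξ => σ * g ξ * ρ ξ]
    _ = -∫ ξ in U, σ * g (T ξ) * ψ ξ := by
        simp [ρ]

lemma HasWeakPartial.ae_unique (hU : IsOpen U) (h : HasWeakPartial U f g i)
    (h' : HasWeakPartial U f' g' i) (hff' : ∀ᵐ ξ ∂(volume.restrict U), f ξ = f' ξ) :
    ∀ᵐ ξ ∂(volume.restrict U), g ξ = g' ξ := by
  have hd := h.sub h'
  have h0 := hU.ae_eq_zero_of_integral_contDiff_smul_eq_zero hd.2.1 fun ψ hψ hc hs => by
    have h1 := hd.2.2 ψ hψ hc hs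
    rw [integral_congr_ae (g := fun _ => (0 : ℝ))
      (by filter_upwards [hff'] with ξ hξ; simp [hξ]), integral_zero,
      setIntegral_mul_of_tsupport_subset hs] at h1
    simp only [smul_eq_mul, mul_comm (ψ _)]
    linarith
  rw [ae_restrict_iff' hU.measurableSet]
  filter_upwards [h0] with ξ hξ hξU
  linarith [hξ hξU]

lemma hasWeakPartial_const (U : Set Plane) (c : ℝ) (i : Fin 2) :
    HasWeakPartial U (fun _ => c) (fun _ => 0) i := by
  refine ⟨(locallyIntegrable_const c).locallyIntegrableOn U,
    (locallyIntegrable_const 0).locallyIntegrableOn U, fun ψ hψ hc hs => ?_⟩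
  rw [setIntegral_mul_of_tsupport_subset
    ((tsupport_partial_subset (EuclideanSpace.single i 1)).trans hs)]
  have hi := (continuous_partial hψ (EuclideanSpace.single i 1)).integrable_of_hasCompactSupport
    (hasCompactSupport_partial hc _) (μ := volume)
  rw [integral_mul_fderiv_eq_neg_fderiv_mul_of_integrable (f := fun _ : Plane => c)]
  · simp
  · simp
  · exact hi.const_mul c
  · exact (hψ.continuous.integrable_of_hasCompactSupport hc).const_mul c
  · fun_prop
  · exact fun ξ _ => hψ.differentiable (by simp) ξ

end WeakPartial

/-! ### Functions with vanishing weak gradient -/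

/-- Mollification: near `x` the smoothed functions have zero gradient, hence are constant, and they
converge almost everywhere to `f`. -/
lemma exists_ae_eq_const_of_weakPartial_eq_zero {U : Set Plane} {f : Plane → ℝ}
    {g : Fin 2 → Plane → ℝ} (hU : IsOpen U) (h : ∀ i, HasWeakPartial U f (g i) i)
    (h0 : ∀ i, ∀ᵐ ξ ∂(volume.restrict U), g i ξ = 0) {x : Plane} (hx : x ∈ U) :
    ∃ V : Set Plane, IsOpen V ∧ x ∈ V ∧ ∃ c : ℝ, ∀ᵐ ξ ∂(volume.restrict V), f ξ = c := by
  have hz : ∀ i, ∀ ψ : Plane → ℝ, ContDiff ℝ ∞ ψ → HasCompactSupport ψ → tsupport ψ ⊆ U →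
      ∫ ξ, f ξ * fderiv ℝ ψ ξ (EuclideanSpace.single i 1) = 0 := by
    intro i ψ hψ hc hs
    have h1 := (h i).2.2 ψ hψ hc hs
    rw [integral_congr_ae (f := fun ξ => g i ξ * ψ ξ) (g := fun _ => (0 : ℝ))
      (by filter_upwards [h0 i] with ξ hξ; simp [hξ]), integral_zero, neg_zero,
      setIntegral_mul_of_tsupport_subset ((tsupport_partial_subset _).trans hs)] at h1
    exact h1
  obtain ⟨ε, hε, hball⟩ := Metric.isOpen_iff.1 hU x hx
  -- For a point within `r` of `x`, a kernel of radius at most `r` sees only the closed ball of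
  -- radius `2r`, which lies in `U`. There the truncation `F` agrees with `f`.
  obtain ⟨r, hr, hrε⟩ : ∃ r > 0, 2 * r < ε := ⟨ε / 3, by positivity, by linarith⟩
  let K := Metric.closedBall x (2 * r)
  have hKU : K ⊆ U := (Metric.closedBall_subset_ball hrε).trans hball
  have hKm : MeasurableSet K := Metric.isClosed_closedBall.measurableSet
  let F := K.indicator f
  have hF : Integrable F := (integrable_indicator_iff hKm).2
    ((h 0).1.integrableOn_compact_subset hKU (isCompact_closedBall x (2 * r)))
  -- The ratio of outer to inner radius stays equal to 2, as almost everywhere convergence requires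
  -- a bound on it.
  let φ : ℕ → ContDiffBump (0 : Plane) := fun n =>
    ⟨r / (2 * (n + 1)), r / (n + 1), by positivity, by
      apply div_lt_div_of_pos_left hr (by positivity)
      have : (0 : ℝ) ≤ n := n.cast_nonneg
      linarith⟩
  let Γ : ℕ → Plane → ℝ := fun n =>
    convolution ((φ n).normed volume) F (ContinuousLinearMap.lsmul ℝ ℝ) volume
  have hconv : ∀ᵐ ξ, Filter.Tendsto (fun n => Γ n ξ) Filter.atTop (𝓝 (F ξ)) := by
    refine ContDiffBump.ae_convolution_tendsto_right_of_locallyIntegrable (K := 2) ?_ ?_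
      hF.locallyIntegrable
    · change Filter.Tendsto (fun n : ℕ => r / ((n : ℝ) + 1)) Filter.atTop (𝓝 0)
      have := (tendsto_one_div_add_atTop_nhds_zero_nat (𝕜 := ℝ)).const_mul r
      simpa [div_eq_mul_inv] using this
    · refine Filter.Eventually.of_forall fun n => le_of_eq ?_
      change r / ((n : ℝ) + 1) = 2 * (r / (2 * (n + 1)))
      field_simp
  have hderiv : ∀ n, ∀ y ∈ Metric.ball x r, HasFDerivAt (Γ n) (0 : Plane →L[ℝ] ℝ) y := by
    intro n y hy
    have hφ : ContDiff ℝ ∞ ((φ n).normed volume) := (φ n).contDiff_normed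
    have hφc : HasCompactSupport ((φ n).normed volume) := (φ n).hasCompactSupport_normed
    have hdir : ∀ i : Fin 2, (convolution F (fderiv ℝ ((φ n).normed volume))
        ((ContinuousLinearMap.lsmul ℝ ℝ).flip.precompR Plane) volume) y
          (EuclideanSpace.single i 1) = 0 := by
      intro i
      rw [convolution_precompR_apply _ hF.locallyIntegrable (hφc.fderiv ℝ)
        (hφ.continuous_fderiv (by simp)), convolution_def]
      -- The reflected kernel is a legitimate test function on `U`; its derivative is minus that of
      -- the kernel, so the weak equation kills the derivative of the convolution.
      let ψ : Plane → ℝ := fun t => (φ n).normed volume (y - t)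
      have hψ : ContDiff ℝ ∞ ψ := hφ.comp (contDiff_const.sub contDiff_id)
      have hψt : tsupport ψ = (fun t => y - t) ⁻¹' Metric.closedBall 0 (φ n).rOut := by
        rw [← (φ n).tsupport_normed_eq (μ := volume)]
        exact tsupport_comp_eq_preimage ((φ n).normed volume) (Homeomorph.subLeft y)
      have hψs : tsupport ψ ⊆ K := by
        rw [hψt]
        intro t ht
        have h2 : (φ n).rOut ≤ r := by
          change r / ((n : ℝ) + 1) ≤ r
          exact div_le_self hr.le (by simp)
        have h3 : ‖y - t‖ ≤ (φ n).rOut := mem_closedBall_zero_iff.1 ht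
        rw [Metric.mem_ball] at hy
        rw [Metric.mem_closedBall]
        calc dist t x ≤ dist t y + dist y x := dist_triangle _ _ _
          _ ≤ 2 * r := by rw [dist_comm t y, dist_eq_norm y t]; linarith
      have hψd : ∀ t v, fderiv ℝ ψ t v = -fderiv ℝ ((φ n).normed volume) (y - t) v := by
        intro t v
        have h2 := ((hφ.differentiable (by simp) (y - t)).hasFDerivAt.comp t
          ((hasFDerivAt_id t).const_sub y)).fderiv
        change fderiv ℝ ψ t = _ at h2
        rw [h2]
        simp
      have h4 := hz i ψ hψ (HasCompactSupport.of_support_subset_isCompact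
        (isCompact_closedBall x (2 * r)) ((subset_tsupport ψ).trans hψs)) (hψs.trans hKU)
      rw [← neg_eq_zero, ← integral_neg, ← h4]
      refine integral_congr_ae (Filter.Eventually.of_forall fun t => ?_)
      simp only [ContinuousLinearMap.flip_apply, ContinuousLinearMap.lsmul_apply, smul_eq_mul]
      by_cases ht : t ∈ K
      · simp only [F, Set.indicator_of_mem ht, hψd]
        ring
      · have h5 : fderiv ℝ ψ t = 0 :=
          image_eq_zero_of_notMem_tsupport fun h => ht (hψs (tsupport_fderiv_subset ℝ h))
        simp only [F, Set.indicator_of_notMem ht, h5]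
        simp
    have hD : (convolution F (fderiv ℝ ((φ n).normed volume))
        ((ContinuousLinearMap.lsmul ℝ ℝ).flip.precompR Plane) volume) y = 0 :=
      ContinuousLinearMap.coe_injective
        ((EuclideanSpace.basisFun (Fin 2) ℝ).toBasis.ext fun i => by simpa using hdir i)
    have h1 := hφc.hasFDerivAt_convolution_right (ContinuousLinearMap.lsmul ℝ ℝ).flip
      hF.locallyIntegrable (hφ.of_le (by simp)) y
    rw [convolution_flip, hD] at h1
    exact h1
  have hconst : ∀ n, ∀ y ∈ Metric.ball x r, Γ n y = Γ n x := by
    intro n y hy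
    refine (convex_ball x r).is_const_of_fderivWithin_eq_zero (𝕜 := ℝ)
      (fun z hz => (hderiv n z hz).differentiableAt.differentiableWithinAt) (fun z hz => ?_) hy
      (Metric.mem_ball_self hr)
    rw [fderivWithin_of_isOpen Metric.isOpen_ball hz, (hderiv n z hz).fderiv]
  refine ⟨Metric.ball x r, Metric.isOpen_ball, Metric.mem_ball_self hr, ?_⟩
  refine ⟨Filter.limUnder Filter.atTop fun n => Γ n x, ?_⟩
  rw [ae_restrict_iff' Metric.isOpen_ball.measurableSet]
  filter_upwards [hconv] with ξ hξ hξb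
  have hξK : ξ ∈ K := Metric.ball_subset_closedBall
    (Metric.ball_subset_ball (by linarith) hξb)
  simp only [hconst _ ξ hξb, F, Set.indicator_of_mem hξK] at hξ
  exact hξ.limUnder_eq.symm

/-- Two different constants cannot coexist on overlapping open sets, since a nonempty open set has
positive measure. So the sets where `f` is `c` and where it is another constant form disjoint open
unions, and connectedness leaves only the first. -/
lemma exists_ae_eq_const_of_isPreconnected {S : Set Plane} (hS : IsConnected S) {f : Plane → ℝ}
    (h : ∀ x ∈ S, ∃ V : Set Plane, IsOpen V ∧ x ∈ V ∧
      ∃ c : ℝ, ∀ᵐ ξ ∂(volume.restrict V), f ξ = c) :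
    ∃ c : ℝ, ∀ᵐ ξ ∂(volume.restrict S), f ξ = c := by
  obtain ⟨x₀, hx₀⟩ := hS.nonempty
  obtain ⟨V₀, hV₀, hxV₀, c, hc⟩ := h x₀ hx₀
  refine ⟨c, ?_⟩
  let A := {V : Set Plane | IsOpen V ∧ ∀ᵐ ξ ∂(volume.restrict V), f ξ = c}
  let B := {V : Set Plane | IsOpen V ∧ ∃ d ≠ c, ∀ᵐ ξ ∂(volume.restrict V), f ξ = d}
  have hAB : Disjoint (⋃₀ A) (⋃₀ B) := by
    rw [Set.disjoint_sUnion_left]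
    rintro V ⟨hV, hVc⟩
    rw [Set.disjoint_sUnion_right]
    rintro W ⟨hW, d, hd, hWd⟩
    rw [Set.disjoint_iff_inter_eq_empty, ← (hV.inter hW).measure_eq_zero_iff volume,
      ← Measure.restrict_eq_zero, ← ae_eq_bot, ← Filter.eventually_false_iff_eq_bot]
    filter_upwards [ae_restrict_of_ae_restrict_of_subset Set.inter_subset_left hVc,
      ae_restrict_of_ae_restrict_of_subset Set.inter_subset_right hWd] with ξ h1 h2
    exact hd (h2.symm.trans h1)
  have hSA : S ⊆ ⋃₀ A := by
    refine hS.isPreconnected.subset_left_of_subset_union (isOpen_sUnion fun V hV => hV.1)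
      (isOpen_sUnion fun V hV => hV.1) hAB (fun x hx => ?_) ⟨x₀, hx₀, V₀, ⟨hV₀, hc⟩, hxV₀⟩
    obtain ⟨V, hV, hxV, d, hd⟩ := h x hx
    by_cases hdc : d = c
    · exact Or.inl ⟨V, ⟨hV, hdc ▸ hd⟩, hxV⟩
    · exact Or.inr ⟨V, ⟨hV, d, hdc, hd⟩, hxV⟩
  have hA : ∀ᵐ ξ ∂(volume.restrict (⋃₀ A)), f ξ = c := by
    rw [ae_restrict_iff' (isOpen_sUnion fun V hV => hV.1).measurableSet, ae_iff]
    -- The union may be uncountable, so nullity of the exceptional set is checked locally.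
    refine measure_null_of_locally_null _ fun x hx => ?_
    simp only [Set.mem_ofPred_eq, Classical.not_imp] at hx
    obtain ⟨⟨V, ⟨hV, hVc⟩, hxV⟩, -⟩ := hx
    refine ⟨_, inter_mem_nhdsWithin _ (hV.mem_nhds hxV), ?_⟩
    rw [ae_restrict_iff' hV.measurableSet, ae_iff] at hVc
    refine measure_mono_null ?_ hVc
    rintro y ⟨hy, hyV⟩
    simp only [Set.mem_ofPred_eq, Classical.not_imp] at hy ⊢
    exact ⟨hyV, hy.2⟩
  exact ae_restrict_of_ae_restrict_of_subset hSA hA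

/-! ### Periodic Sobolev functions -/

section H1per

variable {G : Set Plane} {u : Plane → ℝ} {du : Fin 2 → Plane → ℝ}

lemma shiftIso_preimage (G : Set Plane) (k : Fin 2 → ℤ) :
    shiftIso k ⁻¹' perforatedPlane G = perforatedPlane G := by
  ext ξ
  exact add_lattice_mem_perforatedPlane_iff k ξ

/-- Periodicity is imposed on `u` only; the gradient inherits it by uniqueness of weak derivatives.
-/
lemma MemH1per.periodic_grad (hu : MemH1per G u du) (hG : IsSymmetricPerforation G) (i : Fin 2)
    (k : Fin 2 → ℤ) :
    ∀ᵐ ξ ∂(volume.restrict (perforatedPlane G)), du i (ξ + lattice k) = du i ξ := by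
  have h := (hu.weak_grad i).comp_affineIsometryEquiv hG.isOpen (shiftIso k)
    (shiftIso_preimage G k) (σ := 1) (by rw [shiftIso_linear, one_smul])
  have := h.ae_unique hG.isOpen (hu.weak_grad i) (hu.periodic k)
  simpa only [one_mul, shiftIso_apply] using this

lemma MemH1per.exists_ae_eq_const (hu : MemH1per G u du) (hG : IsSymmetricPerforation G)
    (h0 : ∀ i, ∀ᵐ ξ ∂(volume.restrict (cell G)), du i ξ = 0) :
    ∃ c : ℝ, ∀ᵐ ξ ∂(volume.restrict (cell G)), u ξ = c := by
  refine exists_ae_eq_const_of_isPreconnected hG.connected fun x hx => ?_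
  exact exists_ae_eq_const_of_weakPartial_eq_zero hG.isOpen hu.weak_grad
    (fun i => ae_perforatedPlane_of_ae_cell (hu.periodic_grad hG i) (h0 i) hG.strictly_inside)
    (cell_subset_perforatedPlane G hx)

lemma MemH1per.ae_eq_zero (hu : MemH1per G u du) (hG : IsSymmetricPerforation G)
    (h0 : ∀ i, ∀ᵐ ξ ∂(volume.restrict (cell G)), du i ξ = 0)
    (hmean : ∫ ξ in cell G, u ξ = 0) :
    ∀ᵐ ξ ∂(volume.restrict (perforatedPlane G)), u ξ = 0 := by
  refine ae_perforatedPlane_of_ae_cell hu.periodic ?_ hG.strictly_inside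
  obtain ⟨c, hc⟩ := hu.exists_ae_eq_const hG h0
  have hvol : volume.real (cell G) ≠ 0 :=
    ENNReal.toReal_ne_zero.2 ⟨hG.volume_cell_ne_zero, (volume_cell_lt_top G).ne⟩
  rw [integral_congr_ae hc] at hmean
  have : c = 0 := by simpa [hvol] using hmean
  simpa [this] using hc

lemma memH1per_const (G : Set Plane) (c : ℝ) : MemH1per G (fun _ => c) (fun _ _ => 0) := by
  have : IsFiniteMeasure (volume.restrict (cell G)) := ⟨by simpa using volume_cell_lt_top G⟩
  exact ⟨fun k => by simp, memLp_const c, fun i => memLp_const 0,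
    fun i => hasWeakPartial_const _ c i⟩

lemma MemH1per.const_mul (hu : MemH1per G u du) (c : ℝ) :
    MemH1per G (fun ξ => c * u ξ) (fun i ξ => c * du i ξ) where
  periodic k := by filter_upwards [hu.periodic k] with ξ hξ; rw [hξ]
  memLp := hu.memLp.const_mul c
  memLp_grad i := (hu.memLp_grad i).const_mul c
  weak_grad i := (hu.weak_grad i).const_mul c

lemma MemH1per.sub {v : Plane → ℝ} {dv : Fin 2 → Plane → ℝ} (hu : MemH1per G u du)
    (hv : MemH1per G v dv) :
    MemH1per G (fun ξ => u ξ - v ξ) (fun i ξ => du i ξ - dv i ξ) where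
  periodic k := by
    filter_upwards [hu.periodic k, hv.periodic k] with ξ h1 h2
    rw [h1, h2]
  memLp := hu.memLp.sub hv.memLp
  memLp_grad i := (hu.memLp_grad i).sub (hv.memLp_grad i)
  weak_grad i := (hu.weak_grad i).sub (hv.weak_grad i)

lemma MemH1per.comp_mirror (hu : MemH1per G u du) (hG : IsSymmetricPerforation G) (l : Fin 2) :
    MemH1per G (fun ξ => u (mirror l ξ)) (fun i ξ => reflSign l i * du i (mirror l ξ)) where
  periodic k := by
    have h := (hG.measurePreserving_mirror_restrict l).quasiMeasurePreserving.ae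
      (hu.periodic fun i => if i = l then -k i else k i)
    filter_upwards [h] with ξ hξ
    rw [mirror_add_lattice, hξ]
  memLp := hu.memLp.comp_measurePreserving (hG.measurePreserving_mirror_restrict_cell l)
  memLp_grad i := ((hu.memLp_grad i).comp_measurePreserving
    (hG.measurePreserving_mirror_restrict_cell l)).const_mul _
  weak_grad i := by
    have h := (hu.weak_grad i).comp_affineIsometryEquiv hG.isOpen (mirrorIso l)
      (by rw [coe_mirrorIso, hG.mirror_preimage]) (mirrorIso_linear l i)
    rwa [coe_mirrorIso] at h

/-- The weak gradient of a function of definite parity has the corresponding parity. -/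
lemma MemH1per.grad_parity (hu : MemH1per G u du) (hG : IsSymmetricPerforation G) {l : Fin 2}
    {s : ℝ} (hs : ∀ᵐ ξ ∂(volume.restrict (perforatedPlane G)), u (mirror l ξ) = s * u ξ)
    (i : Fin 2) :
    ∀ᵐ ξ ∂(volume.restrict (perforatedPlane G)),
      du i (mirror l ξ) = reflSign l i * s * du i ξ := by
  have h := ((hu.comp_mirror hG l).weak_grad i).ae_unique hG.isOpen
    ((hu.const_mul s).weak_grad i) hs
  filter_upwards [h] with ξ hξ
  rw [mul_assoc, ← hξ, ← mul_assoc, reflSign_mul_self, one_mul]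

end H1per

/-! ### Parity of weak solutions -/

section Parity

variable {G : Set Plane} {F₀ : Plane → ℝ} {F : Fin 2 → Plane → ℝ} {u : Plane → ℝ}
  {du : Fin 2 → Plane → ℝ}

lemma IsWeakSolution.integral_source_eq_zero (hu : IsWeakSolution G F₀ F u du) :
    ∫ ξ in cell G, F₀ ξ = 0 := by
  have h := hu.equation _ _ (memH1per_const G 1)
  simpa using h.symm

lemma IsWeakSolution.integral_eq_zero (hu : IsWeakSolution G F₀ F u du)
    (hG : IsSymmetricPerforation G) : ∫ ξ in cell G, u ξ = 0 := by
  have h := hu.mean_zero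
  rw [setAverage_eq, smul_eq_mul, mul_eq_zero, inv_eq_zero] at h
  exact h.resolve_left
    (ENNReal.toReal_ne_zero.2 ⟨hG.volume_cell_ne_zero, (volume_cell_lt_top G).ne⟩)

/-- If the data of the problem have parity `s` under the reflection in `{ξ_l = 1/2}`, then so does
its solution. -/
lemma IsWeakSolution.parity (hu : IsWeakSolution G F₀ F u du) (hG : IsSymmetricPerforation G)
    {l : Fin 2} {s : ℝ} (hs : s * s = 1)
    (hF₀ : ∀ᵐ ξ ∂(volume.restrict (cell G)), F₀ (mirror l ξ) = s * F₀ ξ)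
    (hF : ∀ i, ∀ᵐ ξ ∂(volume.restrict (cell G)),
      F i (mirror l ξ) = reflSign l i * s * F i ξ) :
    ∀ᵐ ξ ∂(volume.restrict (perforatedPlane G)), u (mirror l ξ) = s * u ξ := by
  let w : Plane → ℝ := fun ξ => s * u (mirror l ξ) - u ξ
  let dw : Fin 2 → Plane → ℝ := fun i ξ => s * (reflSign l i * du i (mirror l ξ)) - du i ξ
  have hw : MemH1per G w dw := ((hu.mem.comp_mirror hG l).const_mul s).sub hu.mem
  have hwodd : ∀ ξ, w (mirror l ξ) = -(s * w ξ) := fun ξ => by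
    simp only [w, mirror_mirror]
    linear_combination u (mirror l ξ) * hs
  have hdwodd : ∀ i ξ, dw i (mirror l ξ) = -(reflSign l i * s * dw i ξ) := fun i ξ => by
    simp only [dw, mirror_mirror]
    linear_combination du i (mirror l ξ) * (reflSign l i * reflSign l i * hs +
      reflSign_mul_self l i)
  have h0 : ∫ ξ in cell G, F₀ ξ * w ξ = 0 := by
    apply hG.integral_cell_eq_zero_of_odd l
    filter_upwards [hF₀] with ξ hξ
    rw [hξ, hwodd]
    linear_combination (-F₀ ξ * w ξ) * hs
  have h1 : ∫ ξ in cell G, ∑ i, F i ξ * dw i ξ = 0 := by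
    apply hG.integral_cell_eq_zero_of_odd l
    filter_upwards [ae_all_iff.2 hF] with ξ hξ
    rw [← Finset.sum_neg_distrib]
    refine Finset.sum_congr rfl fun i _ => ?_
    rw [hξ, hdwodd]
    linear_combination (-F i ξ * dw i ξ) * (reflSign l i * reflSign l i * hs +
      reflSign_mul_self l i)
  have h2 : ∫ ξ in cell G, ∑ i, du i ξ * dw i ξ = 0 := by
    have h := hu.equation w dw hw
    rw [h0, h1] at h
    linarith
  have hint : Integrable (fun ξ => ∑ i, du i ξ * dw i ξ) (volume.restrict (cell G)) :=
    integrable_finsetSum _ fun i _ => (hu.mem.memLp_grad i).integrable_mul (hw.memLp_grad i)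
  have hint' : Integrable (fun ξ => ∑ i, du i (mirror l ξ) * dw i (mirror l ξ))
      (volume.restrict (cell G)) :=
    (hG.measurePreserving_mirror_restrict_cell l).integrable_comp_of_integrable hint
  -- By the parity of `dw`, the integrand of `h2` plus its mirror image is pointwise `-|∇w|²`.
  have h3 : ∫ ξ in cell G, ∑ i, dw i ξ ^ 2 = 0 := by
    have h := integral_add hint hint'
    rw [hG.integral_cell_comp_mirror l fun ξ => ∑ i, du i ξ * dw i ξ, h2, add_zero,
      ← neg_eq_zero, ← integral_neg] at h
    rw [← h]
    refine integral_congr_ae (Filter.Eventually.of_forall fun ξ => ?_)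
    dsimp only
    rw [← Finset.sum_add_distrib, ← Finset.sum_neg_distrib]
    refine Finset.sum_congr rfl fun i _ => ?_
    rw [hdwodd]
    simp only [dw]
    ring
  have hdw : ∀ i, ∀ᵐ ξ ∂(volume.restrict (cell G)), dw i ξ = 0 := by
    have hi : Integrable (fun ξ => ∑ i, dw i ξ ^ 2) (volume.restrict (cell G)) :=
      integrable_finsetSum _ fun i _ => (hw.memLp_grad i).integrable_sq
    have h := (integral_eq_zero_iff_of_nonneg
      (fun ξ => Finset.sum_nonneg fun i _ => sq_nonneg (dw i ξ)) hi).1 h3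
    intro i
    filter_upwards [h] with ξ hξ
    have := (Finset.sum_eq_zero_iff_of_nonneg fun i _ => sq_nonneg (dw i ξ)).1 hξ i
      (Finset.mem_univ i)
    exact pow_eq_zero_iff two_ne_zero |>.1 this
  have hwmean : ∫ ξ in cell G, w ξ = 0 := by
    have : IsFiniteMeasure (volume.restrict (cell G)) := ⟨by simpa using volume_cell_lt_top G⟩
    rw [integral_sub (((hu.mem.comp_mirror hG l).memLp.integrable one_le_two).const_mul s)
      (hu.mem.memLp.integrable one_le_two), integral_const_mul, hG.integral_cell_comp_mirror l u,
      hu.integral_eq_zero hG, mul_zero, sub_zero]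
  filter_upwards [hw.ae_eq_zero hG hdw hwmean] with ξ hξ
  simp only [w] at hξ
  linear_combination s * hξ - u (mirror l ξ) * hs

end Parity

/-! ### Parity of the correctors -/

lemma neg_one_pow_count_cons (l a : Fin 2) (β : List (Fin 2)) :
    (-1 : ℝ) ^ (a :: β).count l = reflSign l a * (-1) ^ β.count l := by
  by_cases h : a = l <;> simp [reflSign, h, pow_succ]

lemma neg_one_pow_mul_self (n : ℕ) : (-1 : ℝ) ^ n * (-1) ^ n = 1 := by
  rw [← mul_pow]; simp

section Correctors

variable {G : Set Plane} {N : List (Fin 2) → Plane → ℝ} {DN : List (Fin 2) → Fin 2 → Plane → ℝ}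
  {h : List (Fin 2) → ℝ}

lemma IsCellCorrectors.memLp (hN : IsCellCorrectors G N DN h) (α : List (Fin 2)) :
    MemLp (N α) 2 (volume.restrict (cell G)) := by
  rcases α with _ | ⟨a, β⟩
  · have : IsFiniteMeasure (volume.restrict (cell G)) := ⟨by simpa using volume_cell_lt_top G⟩
    rw [show N [] = fun _ => 1 from funext hN.empty]
    exact memLp_const 1
  · exact (hN.solves (a :: β) (by simp)).mem.memLp

/-- The non-constant part of the source has the parity of the word. -/
lemma IsCellCorrectors.source_parity (hN : IsCellCorrectors G N DN h)
    (hG : IsSymmetricPerforation G) (l a b : Fin 2) (γ : List (Fin 2))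
    (hγ : ∀ᵐ ξ ∂(volume.restrict (perforatedPlane G)),
      N γ (mirror l ξ) = (-1) ^ γ.count l * N γ ξ)
    (hbγ : ∀ᵐ ξ ∂(volume.restrict (perforatedPlane G)),
      N (b :: γ) (mirror l ξ) = (-1) ^ (b :: γ).count l * N (b :: γ) ξ) :
    ∀ᵐ ξ ∂(volume.restrict (cell G)),
      (if a = b then N γ (mirror l ξ) else 0) + DN (b :: γ) a (mirror l ξ) =
        (-1) ^ (a :: b :: γ).count l * ((if a = b then N γ ξ else 0) + DN (b :: γ) a ξ) := by
  have hd := (hN.solves (b :: γ) (by simp)).mem.grad_parity hG hbγ a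
  refine ae_restrict_of_ae_restrict_of_subset (cell_subset_perforatedPlane G) ?_
  filter_upwards [hγ, hd] with ξ h1 h2
  rw [h2, h1, neg_one_pow_count_cons l a, mul_add]
  congr 1
  -- When `a = b`, the two leading letters contribute the square of a sign, so `γ` has the parity of
  -- the whole word.
  split_ifs with hab
  · rw [hab, neg_one_pow_count_cons, ← mul_assoc (reflSign l b), reflSign_mul_self, one_mul]
  · rw [mul_zero]

/-- For sign `-1` the solvability condition `∫ F₀ = 0` loses its odd part and leaves `h |Y| = 0`.
The form `h = s h` is what makes the whole source have parity `s`. -/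
lemma IsCellCorrectors.constant_parity (hN : IsCellCorrectors G N DN h)
    (hG : IsSymmetricPerforation G) (l a b : Fin 2) (γ : List (Fin 2))
    (hγ : ∀ᵐ ξ ∂(volume.restrict (perforatedPlane G)),
      N γ (mirror l ξ) = (-1) ^ γ.count l * N γ ξ)
    (hbγ : ∀ᵐ ξ ∂(volume.restrict (perforatedPlane G)),
      N (b :: γ) (mirror l ξ) = (-1) ^ (b :: γ).count l * N (b :: γ) ξ) :
    h (a :: b :: γ) = (-1) ^ (a :: b :: γ).count l * h (a :: b :: γ) := by
  have hp := hN.source_parity hG l a b γ hγ hbγ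
  rcases neg_one_pow_eq_or ℝ ((a :: b :: γ).count l) with hs | hs
  · rw [hs, one_mul]
  rw [hs] at hp ⊢
  have : IsFiniteMeasure (volume.restrict (cell G)) := ⟨by simpa using volume_cell_lt_top G⟩
  have hrest : Integrable (fun ξ => (if a = b then N γ ξ else 0) + DN (b :: γ) a ξ)
      (volume.restrict (cell G)) := by
    refine .add ?_
      (((hN.solves (b :: γ) (by simp)).mem.memLp_grad a).integrable one_le_two)
    split_ifs
    · exact (hN.memLp γ).integrable one_le_two
    · exact integrable_zero _ _ _
  have hodd : ∫ ξ in cell G, ((if a = b then N γ ξ else 0) + DN (b :: γ) a ξ) = 0 := by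
    apply hG.integral_cell_eq_zero_of_odd l
    filter_upwards [hp] with ξ hξ
    rw [hξ, neg_one_mul]
  have h0 := (hN.solves (a :: b :: γ) (by simp)).integral_source_eq_zero
  simp only [source, sub_sub] at h0
  rw [integral_sub (integrable_const _) hrest, hodd, sub_zero, setIntegral_const, smul_eq_mul,
    mul_eq_zero] at h0
  have h1 := h0.resolve_left
    (ENNReal.toReal_ne_zero.2 ⟨hG.volume_cell_ne_zero, (volume_cell_lt_top G).ne⟩)
  rw [h1, mul_zero]

/-- Only the component `i = a` is nonzero, and there the vector sign cancels the sign of the leading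
letter. -/
lemma flux_parity (l a : Fin 2)
    (β : List (Fin 2))
    (hβ : ∀ᵐ ξ ∂(volume.restrict (perforatedPlane G)),
      N β (mirror l ξ) = (-1) ^ β.count l * N β ξ) (i : Fin 2) :
    ∀ᵐ ξ ∂(volume.restrict (cell G)), flux N (a :: β) i (mirror l ξ) =
      reflSign l i * (-1) ^ (a :: β).count l * flux N (a :: β) i ξ := by
  refine ae_restrict_of_ae_restrict_of_subset (cell_subset_perforatedPlane G) ?_
  filter_upwards [hβ] with ξ hξ
  simp only [flux]
  split_ifs with hia
  · rw [hξ, hia, neg_one_pow_count_cons, ← mul_assoc (reflSign l a), reflSign_mul_self]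
    ring
  · rw [mul_zero]

theorem IsCellCorrectors.parity_mirror (hN : IsCellCorrectors G N DN h)
    (hG : IsSymmetricPerforation G) (l : Fin 2) :
    ∀ α : List (Fin 2), ∀ᵐ ξ ∂(volume.restrict (perforatedPlane G)),
      N α (mirror l ξ) = (-1) ^ α.count l * N α ξ
  | [] => by simp [hN.empty]
  | [a] => (hN.solves [a] le_rfl).parity hG (neg_one_pow_mul_self _) (by simp [source])
      (flux_parity l a [] (hN.parity_mirror hG l []))
  | a :: b :: γ => by
      have hγ := hN.parity_mirror hG l γ
      have hbγ := hN.parity_mirror hG l (b :: γ)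
      refine (hN.solves (a :: b :: γ) (by simp)).parity hG (neg_one_pow_mul_self _) ?_
        (flux_parity l a (b :: γ) hbγ)
      have hc := hN.constant_parity hG l a b γ hγ hbγ
      filter_upwards [hN.source_parity hG l a b γ hγ hbγ] with ξ hξ
      simp only [source, sub_sub]
      rw [hξ, mul_sub, ← hc]

theorem IsCellCorrectors.parity_reflect (hN : IsCellCorrectors G N DN h)
    (hG : IsSymmetricPerforation G) (l : Fin 2) (α : List (Fin 2)) (hα : 1 ≤ α.length) :
    ∀ᵐ ξ ∂(volume.restrict (perforatedPlane G)),
      N α (reflect l ξ) = (-1) ^ α.count l * N α ξ := by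
  have h1 := (hG.measurePreserving_reflect_restrict l).quasiMeasurePreserving.ae
    ((hN.solves α hα).mem.periodic (Pi.single l 1))
  filter_upwards [h1, hN.parity_mirror hG l α] with ξ h2 h3
  rw [← h3, mirror_eq_reflect_add, h2]

/-- Continuous functions equal almost everywhere on an open set agree on it, and then on its
closure. -/
theorem IsCellCorrectors.parity_reflect_of_continuousOn (hN : IsCellCorrectors G N DN h)
    (hG : IsSymmetricPerforation G) (l : Fin 2) (α : List (Fin 2)) (hα : 1 ≤ α.length)
    (hc : ContinuousOn (N α) (closure (perforatedPlane G))) :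
    ∀ ξ ∈ closure (perforatedPlane G), N α (reflect l ξ) = (-1) ^ α.count l * N α ξ := by
  have hr : Continuous (reflect l) := by
    rw [← coe_reflectIso]
    exact (reflectIso l).continuous
  have hmaps : Set.MapsTo (reflect l) (closure (perforatedPlane G))
      (closure (perforatedPlane G)) :=
    Set.MapsTo.closure (hG.reflect_preimage l).ge hr
  have h1 : ContinuousOn (fun ξ => N α (reflect l ξ)) (closure (perforatedPlane G)) :=
    hc.comp hr.continuousOn hmaps
  have h2 : ContinuousOn (fun ξ => (-1) ^ α.count l * N α ξ) (closure (perforatedPlane G)) :=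
    continuousOn_const.mul hc
  have h3 := Measure.eqOn_open_of_ae_eq (hN.parity_reflect hG l α hα) hG.isOpen
    (h1.mono subset_closure) (h2.mono subset_closure)
  exact h3.of_subset_closure h1 h2 subset_closure subset_rfl

theorem IsCellCorrectors.constant_eq_zero (hN : IsCellCorrectors G N DN h)
    (hG : IsSymmetricPerforation G) {α : List (Fin 2)} (hα : 2 ≤ α.length) {l : Fin 2}
    (hl : Odd (α.count l)) : h α = 0 := by
  obtain ⟨a, b, γ, rfl⟩ : ∃ a b γ, α = a :: b :: γ := by
    match α, hα with
    | a :: b :: γ, _ => exact ⟨a, b, γ, rfl⟩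
  have hc := hN.constant_parity hG l a b γ (hN.parity_mirror hG l γ)
    (hN.parity_mirror hG l (b :: γ))
  rw [hl.neg_one_pow] at hc
  linarith

lemma count_zero_add_count_one (α : List (Fin 2)) : α.count 0 + α.count 1 = α.length := by
  induction α with
  | nil => rfl
  | cons a β ih => fin_cases a <;> simp <;> omega

end Correctors

end CellProblem

end

theorem lemma3p3 (G : Set CellProblem.Plane) (hG : CellProblem.IsSymmetricPerforation G)
    (N : List (Fin 2) → CellProblem.Plane → ℝ)
    (DN : List (Fin 2) → Fin 2 → CellProblem.Plane → ℝ) (h : List (Fin 2) → ℝ)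
    (hN : CellProblem.IsCellCorrectors G N DN h) :
    (∀ α : List (Fin 2), 1 ≤ α.length → ∀ l : Fin 2,
      (∀ᵐ ξ ∂(volume.restrict (CellProblem.perforatedPlane G)),
        N α (CellProblem.reflect l ξ) = (-1) ^ α.count l * N α ξ) ∧
      (ContinuousOn (N α) (closure (CellProblem.perforatedPlane G)) →
        ∀ ξ ∈ closure (CellProblem.perforatedPlane G),
          N α (CellProblem.reflect l ξ) = (-1) ^ α.count l * N α ξ)) ∧
    (∀ α : List (Fin 2), 2 ≤ α.length → Odd α.length → h α = 0) ∧
    (∀ α : List (Fin 2), 2 ≤ α.length →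
      (∃ l : Fin 2, (-1 : ℤ) ^ α.count l = -1) → h α = 0) := by
  refine ⟨fun α hα l => ⟨hN.parity_reflect hG l α hα,
    hN.parity_reflect_of_continuousOn hG l α hα⟩, fun α hα hodd => ?_, fun α hα => ?_⟩
  -- The two letter counts add up to an odd length, so one of them is odd.
  · rw [← CellProblem.count_zero_add_count_one, Nat.odd_add] at hodd
    by_cases h0 : Odd (α.count 0)
    · exact hN.constant_eq_zero hG hα h0
    · exact hN.constant_eq_zero hG hα
        (Nat.not_even_iff_odd.1 fun he => h0 (hodd.2 he))
  · rintro ⟨l, hl⟩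
    exact hN.constant_eq_zero hG hα (neg_one_pow_eq_neg_one_iff_odd (by decide) |>.1 hl)
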